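/- Let $\Sigma$ and $\Gamma$ be finite alphabets, taken disjoint. A finite timed word over an alphabet is a finite sequence of events $(a_0,t_0)\dots(a_k,t_k)$ (possibly empty) with nonnegative real, weakly increasing timestamps; untiming forgets the timestamps. A timed transducer $\mathcal T$ from $\Sigma$ to $\Gamma$ is a timed automaton over $\Sigma\cup\Gamma$ with finitely many locations, clocks and switches, whose guards are finite conjunctions of terms $x\otimes c$ with $c\in\mathbb Q_{\ge 0}$ and $\otimes\in\{<,\le,=,\ge,>\}$. It defines the relation $[\![\mathcal T]\!]$ of all pairs $(w,v)$ of a timed word $w$ over $\Sigma$ and a timed word $v$ over $\Gamma$ such that $\mathcal T$ accepts a timed word $w\oplus v$ formed by merging the events of $w$ and $v$ in order of time (simultaneous events of $w$ and $v$ may come in any order); $\mathrm{unt}([\![\mathcal T]\!])\subseteq\Sigma^*\times\Gamma^*$ is the set of pairs of untimed words obtained from it. The transducer $\mathcal T$ has no cycles labeled by $\Gamma$ if its graph of locations and switches has no cycle all of whose switches carry letters of $\Gamma$. Its size $|\mathcal T|$ counts letters, locations, clocks and switches with their guards, the constants being written in binary. A discrete transducer $\mathcal T^d$ is a nondeterministic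 finite-state transducer with a finite nonempty set of states and a finite set of transitions $(q,a,u,q')$, $a\in\Sigma$, $u\in\Gamma^*$; $[\![\mathcal T^d]\!]\subseteq\Sigma^*\times\Gamma^*$ is the relation of its accepting runs, and its size counts letters, states and transitions with the lengths of their output words. (i) There is a polynomial $p$ such that for every timed transducer $\mathcal T$ that has no cycles labeled by $\Gamma$ there exists a discrete transducer $\mathcal T^d$ of size at most $2^{p(|\mathcal T|)}$ such that $[\![\mathcal T^d]\!]$ and $\mathrm{unt}([\![\mathcal T]\!])$ coincide, except for pairs $(\varepsilon,t)$ with $t\neq\varepsilon$, which a discrete transducer can never produce: $$[\![\mathcal T^d]\!]=\{(s,t)\in\mathrm{unt}([\![\mathcal T]\!]) : s\neq\varepsilon\text{ or }t=\varepsilon\}.$$ (ii) For every discrete transducer $\mathcal T^d$ there exists a timed transducer $\mathcal T$ that has no cycles labeled by $\Gamma$ such that $\mathrm{unt}([\![\mathcal T]\!])=[\![\mathcal T^d]\!]$. -/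

import Mathlib

open scoped NNReal NNRat

namespace TimedTransduction

/-- A finite timed word: events with nonnegative, weakly increasing timestamps. -/
def TimedWord (A : Type*) : Type _ :=
  {w : List (A × ℝ≥0) // (w.map Prod.snd).Pairwise (· ≤ ·)}

/-- The projection of a timed word to its letters. -/
def TimedWord.untimed {A : Type*} (w : TimedWord A) : List A := w.1.map Prod.fst

/-- `u` is a disjoint union of `w` and `v`: the events of `u` are those of `w` and those of `v`,
tagged by the word they come from. Events of `w` and `v` with equal timestamps may appear in `u`
in either order. -/
def IsDisjointUnion {A B : Type*} (w : TimedWord A) (v : TimedWord B) (u : TimedWord (A ⊕ B)) :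
    Prop :=
  u.1.filterMap (fun e => e.1.getLeft?.map (fun a => (a, e.2))) = w.1 ∧
  u.1.filterMap (fun e => e.1.getRight?.map (fun b => (b, e.2))) = v.1

/-- The untiming of a relation on timed words. -/
def untimedRel {A B : Type*} (R : Set (TimedWord A × TimedWord B)) : Set (List A × List B) :=
  {p | ∃ w v, (w, v) ∈ R ∧ p.1 = w.untimed ∧ p.2 = v.untimed}

/-- The comparison symbols of clock constraints. -/
inductive Cmp
  | lt | le | eq | ge | gt

/-- The meaning of a comparison symbol on nonnegative reals. -/
def Cmp.holds : Cmp → ℝ≥0 → ℝ≥0 → Prop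
  | .lt, x, c => x < c
  | .le, x, c => x ≤ c
  | .eq, x, c => x = c
  | .ge, x, c => x ≥ c
  | .gt, x, c => x > c

/-- A term `clock ⋈ const` of a clock constraint. -/
structure Atom (X : Type*) where
  clock : X
  cmp : Cmp
  const : ℚ≥0

/-- A clock constraint: a finite conjunction of atoms (the empty one is true). -/
abbrev Guard (X : Type*) := List (Atom X)

/-- Satisfaction of a clock constraint by a clock valuation. -/
def Guard.Sat {X : Type*} (g : Guard X) (ν : X → ℝ≥0) : Prop :=
  ∀ c ∈ g, c.cmp.holds (ν c.clock) (c.const : ℝ≥0)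

/-- A switch of a timed automaton. -/
structure Switch (S L X : Type*) where
  source : L
  label : S
  guard : Guard X
  resets : Finset X
  target : L

/-- A timed automaton over the alphabet `S` with locations `L` and clocks `X`. -/
structure TimedAutomaton (S L X : Type*) where
  start : L
  switches : Finset (Switch S L X)
  accepting : Finset L

namespace TimedAutomaton

variable {S L X : Type*}

/-- Elapse of `τ` time units in the transition system on states (location, valuation). -/
def Elapse (τ : ℝ≥0) (q q' : L × (X → ℝ≥0)) : Prop :=
  q'.1 = q.1 ∧ ∀ x, q'.2 x = q.2 x + τ

/-- A location switch labelled by `a`. -/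
def Fire (M : TimedAutomaton S L X) (a : S) (q q' : L × (X → ℝ≥0)) : Prop :=
  ∃ s ∈ M.switches, s.source = q.1 ∧ s.label = a ∧ s.target = q'.1 ∧ s.guard.Sat q.2 ∧
    ∀ x, (x ∈ s.resets → q'.2 x = 0) ∧ (x ∉ s.resets → q'.2 x = q.2 x)

/-- Elapse of `τ` time units followed by a location switch labelled by `a`. -/
def Step (M : TimedAutomaton S L X) (τ : ℝ≥0) (a : S) (q q' : L × (X → ℝ≥0)) : Prop :=
  ∃ r, Elapse τ q r ∧ M.Fire a r q'

/-- `M.Run t q w q'`: from state `q` at absolute time `t`, reading the events `w` (with absolute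
timestamps), the automaton can reach state `q'`. -/
inductive Run (M : TimedAutomaton S L X) :
    ℝ≥0 → L × (X → ℝ≥0) → List (S × ℝ≥0) → L × (X → ℝ≥0) → Prop
  | nil (t : ℝ≥0) (q : L × (X → ℝ≥0)) : Run M t q [] q
  | cons {t t' τ : ℝ≥0} {a : S} {q q' q'' : L × (X → ℝ≥0)} {w : List (S × ℝ≥0)} :
      t' = t + τ → M.Step τ a q q' → Run M t' q' w q'' → Run M t q ((a, t') :: w) q''

/-- Acceptance of a timed word, starting at time `0` with all clocks equal to `0`. -/
def Accepts (M : TimedAutomaton S L X) (w : TimedWord S) : Prop :=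
  ∃ q, M.Run 0 (M.start, fun _ => 0) w.1 q ∧ q.1 ∈ M.accepting

end TimedAutomaton

/-- A timed transducer with input alphabet `A` and output alphabet `B`: a timed automaton whose
alphabet is partitioned into `A` and `B`. -/
abbrev TimedTransducer (A B L X : Type*) := TimedAutomaton (A ⊕ B) L X

namespace TimedTransducer

variable {A B L X : Type*}

/-- The relation on timed words defined by a timed transducer. -/
def relation (T : TimedTransducer A B L X) : Set (TimedWord A × TimedWord B) :=
  {p | ∃ u, IsDisjointUnion p.1 p.2 u ∧ T.Accepts u}

/-- There is an output-labelled switch from `l` to `l'`. -/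
def OutEdge (T : TimedTransducer A B L X) (l l' : L) : Prop :=
  ∃ s ∈ T.switches, s.source = l ∧ s.target = l' ∧ ∃ b : B, s.label = Sum.inr b

/-- No cycle, in the graph of locations and switches, consists of output-labelled switches only. -/
def NoOutputCycle (T : TimedTransducer A B L X) : Prop :=
  ∀ l, ¬ Relation.TransGen T.OutEdge l l

/-- The number of symbols needed to write down a clock constraint, with constants in binary. -/
def guardSize (g : Guard X) : ℕ :=
  (g.map fun c => 2 + (Nat.size c.const.num + Nat.size c.const.den)).sum

/-- The size of a timed transducer, with the constants of the guards in binary. -/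
def size [Fintype A] [Fintype B] [Fintype L] [Fintype X] (T : TimedTransducer A B L X) : ℕ :=
  Fintype.card A + Fintype.card B + Fintype.card L + Fintype.card X + 1 + T.accepting.card +
    ∑ s ∈ T.switches, (3 + guardSize s.guard + s.resets.card)

end TimedTransducer

/-- A discrete (nondeterministic) finite-state transducer with states `Q`: each transition
`(q, a, w, q')` reads one input letter `a` and writes a word `w`. -/
structure DiscreteTransducer (A B Q : Type*) where
  initial : Finset Q
  transitions : Finset (Q × A × List B × Q)
  accepting : Finset Q

namespace DiscreteTransducer

variable {A B Q : Type*}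

/-- `D.Run q s t q'`: there is a run from `q` to `q'` on the input `s` with output `t`. -/
inductive Run (D : DiscreteTransducer A B Q) : Q → List A → List B → Q → Prop
  | nil (q : Q) : Run D q [] [] q
  | cons {q q' q'' : Q} {a : A} {w : List B} {s : List A} {t : List B} :
      (q, a, w, q') ∈ D.transitions → Run D q' s t q'' → Run D q (a :: s) (w ++ t) q''

/-- The relation on words defined by a discrete transducer. -/
def relation (D : DiscreteTransducer A B Q) : Set (List A × List B) :=
  {p | ∃ q ∈ D.initial, ∃ q' ∈ D.accepting, D.Run q p.1 p.2 q'}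

/-- The size of a discrete transducer: alphabets, states, and the total length of all transitions. -/
def size [Fintype A] [Fintype B] [Fintype Q] (D : DiscreteTransducer A B Q) : ℕ :=
  Fintype.card A + Fintype.card B + Fintype.card Q + D.initial.card + D.accepting.card +
    ∑ e ∈ D.transitions, (3 + e.2.2.1.length)

end DiscreteTransducer

end TimedTransduction

namespace TimedTransduction

/-! ### Paths in labelled transition systems -/

/-! Timed to discrete: untimed behaviour only depends on the quotient of the states by a
time-abstract bisimulation, since delays can be chosen anew at every step when a path of the
quotient is lifted (`IsBisimulation.untimedRel_eq`). Such a quotient is supplied by regions. After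
scaling by a common denominator `d` all guard constants are integers at most `M`, and a valuation is
classified by how its clocks and their pairwise differences compare with the integers up to `M`. The
differences fix the order in which clocks will reach integers, so a delay can be imitated from any
equivalent valuation (`RegionEquiv.elapse`).

An output-only path never repeats a location, so it writes at most `Fintype.card L` letters
(`IsBisimulation.length_le`). Each input letter can therefore be bundled with the block of outputs
after it into one discrete transition, and the outputs before the first input letter join the first
transition; only outputs on the empty input have no transition to join (`discretize_relation`). Both
`d` and `M` are exponential in the size, and the number of coordinates of a region is quadratic in
the number of clocks, so there are exponentially many states (`size_bound_aux`).

Discrete to timed: no clocks are needed. Output words are written letter by letter, with the pending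
output stored in the location; every write shortens it, which excludes output cycles. -/

/-- `Path δ q z q'`: the labelled transition system `δ` has a path from `q` to `q'` reading `z`. -/
def Path {Q S : Type*} (δ : Q → S → Q → Prop) : Q → List S → Q → Prop
  | q, [], q' => q = q'
  | q, a :: z, q' => ∃ r, δ q a r ∧ Path δ r z q'

theorem path_append {Q S : Type*} {δ : Q → S → Q → Prop} {z₁ z₂ : List S} {q q' : Q} :
    Path δ q (z₁ ++ z₂) q' ↔ ∃ r, Path δ q z₁ r ∧ Path δ r z₂ q' := by
  induction z₁ generalizing q with
  | nil => simp [Path]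
  | cons a z ih =>
    simp only [List.cons_append, Path, ih]
    constructor
    · rintro ⟨r, h, r', h', h''⟩; exact ⟨r', ⟨r, h, h'⟩, h''⟩
    · rintro ⟨r', ⟨r, h, h'⟩, h''⟩; exact ⟨r, h, r', h', h''⟩

/-- The input letters of a word over a disjoint union of alphabets. -/
def lefts {A B : Type*} (z : List (A ⊕ B)) : List A := z.filterMap Sum.getLeft?

/-- The output letters of a word over a disjoint union of alphabets. -/
def rights {A B : Type*} (z : List (A ⊕ B)) : List B := z.filterMap Sum.getRight?

section Projections

variable {A B : Type*}

@[simp] theorem lefts_nil : lefts ([] : List (A ⊕ B)) = [] := rfl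
@[simp] theorem rights_nil : rights ([] : List (A ⊕ B)) = [] := rfl
@[simp] theorem lefts_inl (a : A) (z : List (A ⊕ B)) :
    lefts (Sum.inl a :: z) = a :: lefts z := rfl
@[simp] theorem lefts_inr (b : B) (z : List (A ⊕ B)) : lefts (Sum.inr b :: z) = lefts z := rfl
@[simp] theorem rights_inl (a : A) (z : List (A ⊕ B)) : rights (Sum.inl a :: z) = rights z := rfl
@[simp] theorem rights_inr (b : B) (z : List (A ⊕ B)) :
    rights (Sum.inr b :: z) = b :: rights z := rfl

@[simp] theorem lefts_append (z₁ z₂ : List (A ⊕ B)) :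
    lefts (z₁ ++ z₂) = lefts z₁ ++ lefts z₂ := List.filterMap_append

@[simp] theorem rights_append (z₁ z₂ : List (A ⊕ B)) :
    rights (z₁ ++ z₂) = rights z₁ ++ rights z₂ := List.filterMap_append

@[simp] theorem lefts_map_inr (u : List B) : lefts (u.map (Sum.inr : B → A ⊕ B)) = [] := by
  induction u <;> simp_all

@[simp] theorem rights_map_inr (u : List B) : rights (u.map (Sum.inr : B → A ⊕ B)) = u := by
  induction u <;> simp_all

end Projections

/-- The pairs of words read along the paths from `q₀` to a state satisfying `acc`. -/
def pathRel {Q A B : Type*} (δ : Q → A ⊕ B → Q → Prop) (q₀ : Q) (acc : Q → Prop) :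
    Set (List A × List B) :=
  {st | ∃ z q, lefts z = st.1 ∧ rights z = st.2 ∧ Path δ q₀ z q ∧ acc q}

/-! ### Untiming through a finite abstraction of the states -/

section Untiming

variable {A B L X Q : Type*}

theorem TimedAutomaton.Run.pairwise {S : Type*} {M : TimedAutomaton S L X} {t : ℝ≥0}
    {p p' : L × (X → ℝ≥0)} {u : List (S × ℝ≥0)} (h : M.Run t p u p') :
    (∀ e ∈ u, t ≤ e.2) ∧ (u.map Prod.snd).Pairwise (· ≤ ·) := by
  induction h with
  | nil => simp
  | @cons t t' τ a q q' q'' w ht hs hr ih =>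
    have htt : t ≤ t' := by rw [ht]; exact le_self_add
    refine ⟨?_, ?_⟩
    · intro e he
      rcases List.mem_cons.1 he with rfl | he
      · exact htt
      · exact htt.trans (ih.1 e he)
    · rw [List.map_cons, List.pairwise_cons]
      refine ⟨?_, ih.2⟩
      intro x hx
      obtain ⟨e, he, rfl⟩ := List.mem_map.1 hx
      exact ih.1 e he

/-- An untimed word is accepted by a timed transducer after some choice of timestamps iff it is the
label of an accepting run. -/
theorem mem_untimedRel_iff (T : TimedTransducer A B L X) (st : List A × List B) :
    st ∈ untimedRel T.relation ↔ ∃ u q, T.Run 0 (T.start, fun _ => 0) u q ∧ q.1 ∈ T.accepting ∧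
      lefts (u.map Prod.fst) = st.1 ∧ rights (u.map Prod.fst) = st.2 := by
  have hl : ∀ u : List ((A ⊕ B) × ℝ≥0),
      (u.filterMap (fun e => e.1.getLeft?.map (fun a => (a, e.2)))).map Prod.fst =
        lefts (u.map Prod.fst) := by
    intro u
    induction u with
    | nil => rfl
    | cons e u ih =>
      rcases e with ⟨a | _, _⟩
      · exact congrArg (a :: ·) ih
      · exact ih
  have hr : ∀ u : List ((A ⊕ B) × ℝ≥0),
      (u.filterMap (fun e => e.1.getRight?.map (fun a => (a, e.2)))).map Prod.fst =
        rights (u.map Prod.fst) := by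
    intro u
    induction u with
    | nil => rfl
    | cons e u ih =>
      rcases e with ⟨_ | b, _⟩
      · exact ih
      · exact congrArg (b :: ·) ih
  constructor
  · rintro ⟨w, v, ⟨u, ⟨hw, hv⟩, q, hq, hacc⟩, h1, h2⟩
    refine ⟨u.1, q, hq, hacc, ?_, ?_⟩
    · rw [h1, TimedWord.untimed, ← hl]; exact congrArg _ hw
    · rw [h2, TimedWord.untimed, ← hr]; exact congrArg _ hv
  · rintro ⟨u, q, hq, hacc, h1, h2⟩
    have hs := hq.pairwise.2
    rw [List.pairwise_map] at hs
    refine ⟨⟨u.filterMap (fun e => e.1.getLeft?.map (fun a => (a, e.2))), ?_⟩,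
      ⟨u.filterMap (fun e => e.1.getRight?.map (fun a => (a, e.2))), ?_⟩,
      ⟨⟨u, hq.pairwise.2⟩, ⟨rfl, rfl⟩, q, hq, hacc⟩, ?_, ?_⟩
    · rw [List.pairwise_map, List.pairwise_filterMap]
      refine hs.imp ?_
      intro e e' h x hx y hy
      simp only [Option.map_eq_some_iff] at hx hy
      obtain ⟨_, _, rfl⟩ := hx
      obtain ⟨_, _, rfl⟩ := hy
      exact h
    · rw [List.pairwise_map, List.pairwise_filterMap]
      refine hs.imp ?_
      intro e e' h x hx y hy
      simp only [Option.map_eq_some_iff] at hx hy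
      obtain ⟨_, _, rfl⟩ := hx
      obtain ⟨_, _, rfl⟩ := hy
      exact h
    · rw [← h1, ← hl]; rfl
    · rw [← h2, ← hr]; rfl

/-- The transitions between abstract states that are witnessed by concrete steps. -/
def absStep (T : TimedTransducer A B L X) (abs : L × (X → ℝ≥0) → Q) (q : Q) (a : A ⊕ B) (q' : Q) :
    Prop :=
  ∃ p p' τ, abs p = q ∧ abs p' = q' ∧ T.Step τ a p p'

/-- The abstract states of the accepting concrete states. -/
def absAcc (T : TimedTransducer A B L X) (abs : L × (X → ℝ≥0) → Q) (q : Q) : Prop :=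
  ∃ p, abs p = q ∧ p.1 ∈ T.accepting

/-- `abs` is the quotient map of a time-abstract bisimulation that respects locations. -/
structure IsBisimulation (T : TimedTransducer A B L X) (abs : L × (X → ℝ≥0) → Q) : Prop where
  loc : ∀ p p', abs p = abs p' → p.1 = p'.1
  step : ∀ p₁ p₂ a τ p₁', abs p₁ = abs p₂ → T.Step τ a p₁ p₁' →
    ∃ τ' p₂', T.Step τ' a p₂ p₂' ∧ abs p₂' = abs p₁'

theorem TimedAutomaton.Run.path {T : TimedTransducer A B L X} (abs : L × (X → ℝ≥0) → Q) {t : ℝ≥0}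
    {p p' : L × (X → ℝ≥0)} {u : List ((A ⊕ B) × ℝ≥0)} (h : T.Run t p u p') :
    Path (absStep T abs) (abs p) (u.map Prod.fst) (abs p') := by
  induction h with
  | nil => rfl
  | cons ht hs hr ih => exact ⟨_, ⟨_, _, _, rfl, rfl, hs⟩, ih⟩

/-- Each abstract step is witnessed from some state of the class, and the bisimulation moves it to
the state actually reached, at the price of another delay. The timestamps are built from these new
delays. -/
theorem IsBisimulation.exists_run {T : TimedTransducer A B L X} {abs : L × (X → ℝ≥0) → Q}
    (h : IsBisimulation T abs) {z : List (A ⊕ B)} {q' : Q} :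
    ∀ (t : ℝ≥0) (p : L × (X → ℝ≥0)), Path (absStep T abs) (abs p) z q' →
      ∃ u p', T.Run t p u p' ∧ abs p' = q' ∧ u.map Prod.fst = z := by
  induction z with
  | nil => intro t p hz; exact ⟨[], p, .nil t p, hz, rfl⟩
  | cons a z ih =>
    rintro t p ⟨r, ⟨p₁, p₁', τ, h1, rfl, hs⟩, hz⟩
    obtain ⟨τ', p₂', hs', he⟩ := h.step _ p _ _ _ h1 hs
    rw [← he] at hz
    obtain ⟨u, p', hu, hp', rfl⟩ := ih (t + τ') p₂' hz
    exact ⟨(a, t + τ') :: u, p', .cons rfl hs' hu, hp', rfl⟩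

theorem IsBisimulation.untimedRel_eq {T : TimedTransducer A B L X} {abs : L × (X → ℝ≥0) → Q}
    (h : IsBisimulation T abs) :
    untimedRel T.relation =
      pathRel (absStep T abs) (abs (T.start, fun _ => 0)) (absAcc T abs) := by
  ext st
  rw [mem_untimedRel_iff]
  constructor
  · rintro ⟨u, q, hu, hq, h1, h2⟩
    exact ⟨_, _, h1, h2, hu.path abs, q, rfl, hq⟩
  · rintro ⟨z, q, h1, h2, hz, p, hp, hacc⟩
    obtain ⟨u, p', hu, hp', rfl⟩ := h.exists_run 0 _ hz
    exact ⟨u, p', hu, by rwa [h.loc p' p (hp'.trans hp.symm)], h1, h2⟩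

/-- Paths of output letters are bounded by the number of locations. -/
theorem IsBisimulation.length_le [Fintype L] {T : TimedTransducer A B L X}
    {abs : L × (X → ℝ≥0) → Q} (h : IsBisimulation T abs) (hT : T.NoOutputCycle) {u : List B}
    {q q' : Q} (hu : Path (absStep T abs) q (u.map Sum.inr) q') : u.length ≤ Fintype.card L := by
  classical
  by_cases hne : u = []
  · simp [hne]
  have key : ∀ (u : List B) (p : L × (X → ℝ≥0)),
      Path (absStep T abs) (abs p) (u.map Sum.inr) q' →
      ∃ s : Finset L, s.card = u.length ∧ ∀ l ∈ s, Relation.TransGen T.OutEdge p.1 l := by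
    intro u
    induction u with
    | nil => intro p _; exact ⟨∅, rfl, by simp⟩
    | cons b u ih =>
      rintro p ⟨r, ⟨p₁, p₂, τ, h1, rfl, hs⟩, hz⟩
      obtain ⟨s, hs1, hs2⟩ := ih p₂ hz
      have hedge : T.OutEdge p.1 p₂.1 := by
        obtain ⟨r, hr, w, hw, hw1, hw2, hw3, -⟩ := hs
        exact ⟨w, hw, by rw [hw1, hr.1, h.loc _ _ h1], hw3, b, hw2⟩
      refine ⟨insert p₂.1 s, ?_, ?_⟩
      -- If `p₂.1` were already in `s`, output switches would lead from it back to itself.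
      · rw [Finset.card_insert_of_notMem fun hmem => hT _ (hs2 _ hmem), hs1, List.length_cons]
      · intro l hl
        rcases Finset.mem_insert.1 hl with rfl | hl
        · exact .single hedge
        · exact .head hedge (hs2 l hl)
  -- A state outside the range of `abs` has no outgoing step, so only the empty word, settled above,
  -- can start there.
  obtain ⟨p, rfl⟩ : ∃ p, abs p = q := by
    cases u with
    | nil => exact absurd rfl hne
    | cons b u => obtain ⟨r, ⟨p, _, _, hp, _⟩, _⟩ := hu; exact ⟨p, hp⟩
  obtain ⟨s, hs, -⟩ := key u p hu
  rw [← hs]; exact s.card_le_univ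

end Untiming

/-! ### Region equivalence -/

/-- The position of `r` relative to the integers between `-M` and `M`. -/
noncomputable def position (M : ℕ) (r : ℝ) : ℤ :=
  max (-(2 * M + 1)) (min (2 * M + 1) (⌊r⌋ + ⌈r⌉))

theorem position_mem (M : ℕ) (r : ℝ) :
    position M r ∈ Finset.Icc (-(2 * M + 1) : ℤ) (2 * M + 1) := by
  rw [Finset.mem_Icc, position]; omega

/-- The sum `⌊r⌋ + ⌈r⌉` is `2 * n` at an integer `n` and `2 * n + 1` strictly between `n` and `n +
1`. Truncating it at `±(2 * M + 1)` leaves its comparisons with `2 * c` intact for `|c| ≤ M`. -/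
theorem lt_iff_position {M : ℕ} {r : ℝ} {c : ℤ} (h1 : -(M : ℤ) ≤ c) (h2 : c ≤ M) :
    r < c ↔ position M r < 2 * c := by
  have h3 : r < c ↔ ⌊r⌋ < c := Int.floor_lt.symm
  have h4 : ⌈r⌉ ≤ ⌊r⌋ + 1 := Int.ceil_le_floor_add_one r
  have h5 := Int.floor_le_ceil r
  rw [h3, position]; omega

theorem le_iff_position {M : ℕ} {r : ℝ} {c : ℤ} (h1 : -(M : ℤ) ≤ c) (h2 : c ≤ M) :
    r ≤ c ↔ position M r ≤ 2 * c := by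
  have h3 : r ≤ c ↔ ⌈r⌉ ≤ c := Int.ceil_le.symm
  have h4 : ⌈r⌉ ≤ ⌊r⌋ + 1 := Int.ceil_le_floor_add_one r
  have h5 := Int.floor_le_ceil r
  rw [h3, position]; omega

/-- `r` and `r'` compare in the same way to the integer `c`. -/
def SameSide (r r' : ℝ) (c : ℤ) : Prop := (r < c ↔ r' < c) ∧ (r ≤ c ↔ r' ≤ c)

theorem position_eq_iff {M : ℕ} {r r' : ℝ} :
    position M r = position M r' ↔ ∀ c : ℤ, -(M : ℤ) ≤ c → c ≤ M → SameSide r r' c := by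
  constructor
  · intro h c h1 h2
    rw [SameSide, lt_iff_position h1 h2, le_iff_position h1 h2, lt_iff_position h1 h2,
      le_iff_position h1 h2, h]
    exact ⟨Iff.rfl, Iff.rfl⟩
  · intro h
    have key : ∀ c : ℤ, -(M : ℤ) ≤ c → c ≤ M →
        (position M r < 2 * c ↔ position M r' < 2 * c) ∧
          (position M r ≤ 2 * c ↔ position M r' ≤ 2 * c) := by
      intro c h1 h2
      have := h c h1 h2
      rwa [SameSide, lt_iff_position h1 h2, le_iff_position h1 h2, lt_iff_position h1 h2,
        le_iff_position h1 h2] at this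
    have m1 := Finset.mem_Icc.1 (position_mem M r)
    have m2 := Finset.mem_Icc.1 (position_mem M r')
    generalize position M r = a at *
    generalize position M r' = b at *
    -- The smaller of two distinct positions is separated from the other at its half if it is even,
    -- and at the next integer if it is odd.
    have k1 := key (a / 2)
    have k2 := key (b / 2)
    have k3 := key (a / 2 + 1)
    have k4 := key (b / 2 + 1)
    omega

/-- Two (scaled) clock valuations are region equivalent up to the constant `M`: clocks and
differences of clocks compare in the same way to integers up to `M`. -/
structure RegionEquiv {X : Type*} (M : ℕ) (a b : X → ℝ) : Prop where
  clock : ∀ x (c : ℤ), 0 ≤ c → c ≤ M → SameSide (a x) (b x) c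
  diff : ∀ x y (c : ℤ), -(M : ℤ) ≤ c → c ≤ M → SameSide (a x - a y) (b x - b y) c

/-- The region of a valuation. -/
noncomputable def region {X : Type*} (M : ℕ) (a : X → ℝ) :
    X ⊕ X × X → Finset.Icc (-(2 * M + 1) : ℤ) (2 * M + 1)
  | .inl x => ⟨position M (a x), position_mem M _⟩
  | .inr (x, y) => ⟨position M (a x - a y), position_mem M _⟩

theorem SameSide.of_neg {r r' : ℝ} {c : ℤ} (hr : 0 ≤ r) (hr' : 0 ≤ r') (hc : c < 0) :
    SameSide r r' c := by
  have : (c : ℝ) < 0 := by exact_mod_cast hc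
  constructor <;> constructor <;> intro h <;> linarith

theorem SameSide.neg {r r' : ℝ} {c : ℤ} (h : SameSide r r' (-c)) : SameSide (-r) (-r') c := by
  obtain ⟨h1, h2⟩ := h
  push_cast at h1 h2
  refine ⟨?_, ?_⟩
  · rw [neg_lt (a := r), neg_lt (a := r'), ← not_le, ← not_le, h2]
  · rw [neg_le (a := r), neg_le (a := r'), ← not_lt, ← not_lt, h1]

/-- Regions also record comparisons of clocks with negative integers; for nonnegative valuations
these carry no information. -/
theorem region_eq_iff {X : Type*} {M : ℕ} {a b : X → ℝ} (ha : ∀ x, 0 ≤ a x) (hb : ∀ x, 0 ≤ b x) :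
    region M a = region M b ↔ RegionEquiv M a b := by
  constructor
  · intro h
    refine ⟨fun x c h0 hM => ?_, fun x y => ?_⟩
    · have := congrArg Subtype.val (congrFun h (.inl x))
      exact position_eq_iff.1 this c (by omega) hM
    · have := congrArg Subtype.val (congrFun h (.inr (x, y)))
      exact position_eq_iff.1 this
  · intro h
    funext i
    apply Subtype.ext
    rcases i with x | ⟨x, y⟩
    · refine position_eq_iff.2 fun c h1 h2 => ?_
      by_cases hc : c < 0
      · exact SameSide.of_neg (ha x) (hb x) hc
      · exact h.clock x c (by omega) h2
    · exact position_eq_iff.2 (h.diff x y)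

/-- A point can be moved along an order isomorphism between finite sets of reals. -/
theorem exists_same_cut {I : Type*} [Finite I] {f g : I → ℝ} (h : ∀ i j, f i < f j ↔ g i < g j)
    (t : ℝ) : ∃ t', ∀ i, (f i < t ↔ g i < t') ∧ (t < f i ↔ t' < g i) := by
  classical
  cases nonempty_fintype I
  by_cases ht : ∃ i, f i = t
  · obtain ⟨i, rfl⟩ := ht
    exact ⟨g i, fun j => ⟨h j i, h i j⟩⟩
  · push Not at ht
    -- When `t` misses all points, `t'` is found in the gap between the images of the points below
    -- and above it.
    obtain ⟨t', h1, h2⟩ := Order.exists_between_finsets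
      (lo := (Finset.univ.filter fun i => f i < t).image g)
      (hi := (Finset.univ.filter fun i => t < f i).image g) (by
        intro x hx y hy
        simp only [Finset.mem_image, Finset.mem_filter, Finset.mem_univ, true_and] at hx hy
        obtain ⟨i, hi, rfl⟩ := hx
        obtain ⟨j, hj, rfl⟩ := hy
        exact (h i j).1 (hi.trans hj))
    simp only [Finset.mem_image, Finset.mem_filter, Finset.mem_univ, true_and,
      forall_exists_index, and_imp, forall_apply_eq_imp_iff₂] at h1 h2
    refine ⟨t', fun i => ?_⟩
    rcases lt_or_gt_of_ne (ht i) with hi | hi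
    · exact ⟨iff_of_true hi (h1 i hi), iff_of_false hi.not_gt (h1 i hi).not_gt⟩
    · exact ⟨iff_of_false hi.not_gt (h2 i hi).not_gt, iff_of_true hi (h2 i hi)⟩

/-- Clock `x` reaches the integer `c` after the delay `c - a x`. The order of two such delays is a
comparison of `a y - a x` with `c' - c`, and their order relative to `0` is a comparison of a clock
with an integer; both are fixed by the equivalence. So `t` can be placed at the same position among
the corresponding delays for `b`, the point `0` ensuring `0 ≤ t'`. Differences do not change with
time. -/
theorem RegionEquiv.elapse {X : Type*} [Finite X] {M : ℕ} {a b : X → ℝ} (h : RegionEquiv M a b)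
    {t : ℝ} (ht : 0 ≤ t) :
    ∃ t', 0 ≤ t' ∧ RegionEquiv M (fun x => a x + t) (fun x => b x + t') := by
  obtain ⟨t', ht'⟩ := exists_same_cut (I := Option (X × Fin (M + 1)))
    (f := fun i => i.elim 0 fun p => (p.2 : ℝ) - a p.1)
    (g := fun i => i.elim 0 fun p => (p.2 : ℝ) - b p.1) (by
      rintro (_ | ⟨x, c⟩) (_ | ⟨y, c'⟩)
      · simp
      · have := (h.clock y c' (by omega) (by omega)).1
        simpa using this
      · have := (h.clock x c (by omega) (by omega)).2
        simpa using not_congr this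
      · have := (h.diff y x ((c' : ℤ) - c) (by omega) (by omega)).1
        push_cast at this
        simp only [Option.elim_some]
        constructor
        · intro h'; linarith [this.1 (by linarith)]
        · intro h'; linarith [this.2 (by linarith)]) t
  refine ⟨t', ?_, ?_, ?_⟩
  · have := (ht' none).2
    simp only [Option.elim_none] at this
    exact not_lt.1 fun h' => ht.not_gt (this.2 h')
  · intro x c h0 hM
    lift c to ℕ using h0
    have := ht' (some (x, ⟨c, by omega⟩))
    simp only [Option.elim_some] at this
    refine ⟨?_, ?_⟩
    · have := this.2
      rw [lt_sub_iff_add_lt', lt_sub_iff_add_lt'] at this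
      simpa using this
    · have := not_congr this.1
      rw [not_lt, not_lt, le_sub_iff_add_le', le_sub_iff_add_le'] at this
      simpa using this
  · intro x y c h1 h2
    simpa using h.diff x y c h1 h2

open Classical in
-- Resetting one of two clocks turns their difference into plus or minus the other clock, whose
-- comparison with negative integers is settled by nonnegativity.
theorem RegionEquiv.reset {X : Type*} {M : ℕ} {a b : X → ℝ} (h : RegionEquiv M a b)
    (ha : ∀ x, 0 ≤ a x) (hb : ∀ x, 0 ≤ b x) (s : Finset X) :
    RegionEquiv M (fun x => if x ∈ s then 0 else a x) (fun x => if x ∈ s then 0 else b x) := by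
  have key : ∀ x (c : ℤ), c ≤ M → SameSide (a x) (b x) c := by
    intro x c hM
    by_cases hc : c < 0
    · exact SameSide.of_neg (ha x) (hb x) hc
    · exact h.clock x c (by omega) hM
  refine ⟨fun x c h0 hM => ?_, fun x y c h1 h2 => ?_⟩
  · split_ifs
    · exact ⟨Iff.rfl, Iff.rfl⟩
    · exact key x c hM
  · split_ifs
    · exact ⟨Iff.rfl, Iff.rfl⟩
    · rw [zero_sub, zero_sub]; exact (key y (-c) (by omega)).neg
    · rw [sub_zero, sub_zero]; exact key x c h2
    · exact h.diff x y c h1 h2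

/-! ### The region quotient as a time-abstract bisimulation -/

section RegionAbstraction

variable {A B L X : Type*}

/-- `d` is a common denominator of the constants of `T`, and `M` bounds their multiples by `d`. -/
def IsScale (T : TimedTransducer A B L X) (d M : ℕ) : Prop :=
  0 < d ∧ ∀ s ∈ T.switches, ∀ c ∈ s.guard, ∃ k : ℕ, k ≤ M ∧ (d : ℚ≥0) * c.const = k

/-- The location of a state together with the region of its valuation. -/
noncomputable def regionAbs (d M : ℕ) (p : L × (X → ℝ≥0)) :
    L × (X ⊕ X × X → Finset.Icc (-(2 * M + 1) : ℤ) (2 * M + 1)) :=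
  (p.1, region M fun x => (d : ℝ) * p.2 x)

theorem Guard.sat_of_regionEquiv {d M : ℕ} (hd : 0 < d) {g : Guard X} {ν μ : X → ℝ≥0}
    (hg : ∀ c ∈ g, ∃ k : ℕ, k ≤ M ∧ (d : ℚ≥0) * c.const = k)
    (h : RegionEquiv M (fun x => (d : ℝ) * ν x) (fun x => (d : ℝ) * μ x)) (hs : g.Sat ν) :
    g.Sat μ := by
  intro c hc
  obtain ⟨k, hk, hck⟩ := hg c hc
  have hd' : (0 : ℝ) < d := by exact_mod_cast hd
  have hck' : (d : ℝ) * ((c.const : ℝ≥0) : ℝ) = k := by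
    have := congrArg (fun q : ℚ≥0 => ((q : ℝ≥0) : ℝ)) hck
    push_cast at this ⊢
    exact this
  obtain ⟨h1, h2⟩ := h.clock c.clock k (by omega) (by omega)
  simp only [Int.cast_natCast, ← hck', mul_lt_mul_iff_right₀ hd', mul_le_mul_iff_right₀ hd',
    NNReal.coe_lt_coe, NNReal.coe_le_coe] at h1 h2
  have := hs c hc
  generalize c.cmp = o at *
  cases o <;> simp only [Cmp.holds] at this ⊢
  · exact h1.1 this
  · exact h2.1 this
  · exact le_antisymm (h2.1 this.le) (not_lt.1 fun h' => (h1.2 h').ne this)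
  · exact not_lt.1 fun h' => absurd (h1.2 h') (not_lt.2 this)
  · exact not_le.1 fun h' => absurd (h2.2 h') (not_le.2 this)

theorem IsScale.isBisimulation [Finite X] {T : TimedTransducer A B L X} {d M : ℕ}
    (hT : IsScale T d M) : IsBisimulation T (regionAbs d M) := by
  classical
  have hd : (0 : ℝ) < d := by exact_mod_cast hT.1
  have hnn : ∀ (ν : X → ℝ≥0) x, 0 ≤ (d : ℝ) * ν x := fun ν x => by positivity
  refine ⟨fun p p' h => (Prod.ext_iff.1 h).1, ?_⟩
  rintro ⟨l₁, ν⟩ ⟨l₂, μ⟩ a τ ⟨l', ν'⟩ heq ⟨⟨l₀, r⟩, ⟨hl, hr⟩, s, hs, h1, h2, h3, h4, h5⟩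
  have hloc : l₁ = l₂ := congrArg Prod.fst heq
  have hreg := (region_eq_iff (hnn ν) (hnn μ)).1 (congrArg Prod.snd heq)
  subst hloc
  dsimp only at hl hr h1 h3 h4 h5
  -- Regions live in time scaled by `d`: the delay `τ` becomes `d * τ`, and the answer `t'` is
  -- scaled back to `t' / d`.
  obtain ⟨t', ht', hel⟩ := hreg.elapse (t := d * τ) (by positivity)
  have hr' : r = fun x => ν x + τ := funext hr
  subst hr'
  have hel' : RegionEquiv M (fun x => (d : ℝ) * ((ν x + τ : ℝ≥0) : ℝ))
      (fun x => (d : ℝ) * ((μ x + (t' / d).toNNReal : ℝ≥0) : ℝ)) := by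
    convert hel using 2 with x x
    · push_cast; ring
    · rw [NNReal.coe_add, Real.coe_toNNReal _ (by positivity)]; field_simp
  refine ⟨(t' / d).toNNReal,
    (l', fun x => if x ∈ s.resets then 0 else μ x + (t' / d).toNNReal),
    ⟨(l₁, fun x => μ x + (t' / d).toNNReal), ⟨rfl, fun x => rfl⟩, s, hs, h1.trans hl, h2, h3,
      Guard.sat_of_regionEquiv hT.1 (hT.2 s hs) hel' h4, fun x => ⟨fun hx => if_pos hx,
        fun hx => if_neg hx⟩⟩, ?_⟩
  refine Prod.ext rfl ((region_eq_iff (hnn _) (hnn _)).2 ?_)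
  have hν' : ν' = fun x => if x ∈ s.resets then 0 else ν x + τ := by
    funext x
    split_ifs with hx
    · exact (h5 x).1 hx
    · exact (h5 x).2 hx
  have hsymm : RegionEquiv M (fun x => (d : ℝ) * ((μ x + (t' / d).toNNReal : ℝ≥0) : ℝ))
      (fun x => (d : ℝ) * ((ν x + τ : ℝ≥0) : ℝ)) :=
    ⟨fun x c hc hc' => ⟨(hel'.clock x c hc hc').1.symm, (hel'.clock x c hc hc').2.symm⟩,
      fun x y c hc hc' => ⟨(hel'.diff x y c hc hc').1.symm, (hel'.diff x y c hc hc').2.symm⟩⟩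
  convert hsymm.reset (hnn _) (hnn _) s.resets using 2 with x x
  · dsimp only; split_ifs <;> simp
  · rw [hν']; dsimp only; split_ifs <;> simp

end RegionAbstraction

/-! ### Words of bounded length -/

/-- The words of length at most `k`. -/
noncomputable def boundedWords (B : Type*) [Fintype B] (k : ℕ) : Finset (List B) := by
  classical
  exact Finset.univ.image fun f : Fin k → Option B => (List.ofFn f).reduceOption

theorem mem_boundedWords {B : Type*} [Fintype B] {k : ℕ} {u : List B} :
    u ∈ boundedWords B k ↔ u.length ≤ k := by
  classical
  simp only [boundedWords, Finset.mem_image, Finset.mem_univ, true_and]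
  constructor
  · rintro ⟨f, rfl⟩
    exact (List.reduceOption_length_le _).trans (List.length_ofFn).le
  · intro h
    have hrep : ∀ n, (List.replicate n (none : Option B)).reduceOption = [] := by simp
    have hmap : ∀ v : List B, (v.map some).reduceOption = v := by
      intro v
      induction v <;> simp_all
    have hlen : (u.map some ++ List.replicate (k - u.length) none).length = k := by
      simp; omega
    -- The word is padded with `none` to length exactly `k`.
    refine ⟨fun i => (u.map some ++ List.replicate (k - u.length) none)[i], ?_⟩
    have : List.ofFn (fun i : Fin k =>
        (u.map some ++ List.replicate (k - u.length) none)[i]) =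
        u.map some ++ List.replicate (k - u.length) none := by
      apply List.ext_getElem
      · simp; omega
      · intro i h1 h2; simp
    rw [this, List.reduceOption_append, hrep, List.append_nil, hmap]

theorem card_boundedWords_le (B : Type*) [Fintype B] (k : ℕ) :
    (boundedWords B k).card ≤ (Fintype.card B + 1) ^ k := by
  classical
  refine Finset.card_image_le.trans ?_
  simp

/-! ### Discrete transducers from labelled transition systems -/

section Discrete

variable {A B Q : Type*}

/-- The moves of the transducer that reads a letter together with the outputs that follow it; its
first move, from the state `none`, also writes the outputs that precede the letter. -/
def Move (δ : Q → A ⊕ B → Q → Prop) (q₀ : Q) : Option Q × A × List B × Option Q → Prop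
  | (some q, a, u, some q') => Path δ q (Sum.inl a :: u.map Sum.inr) q'
  | (none, a, u, some q') => ∃ u₁ u₂, u = u₁ ++ u₂ ∧
      Path δ q₀ (u₁.map Sum.inr ++ Sum.inl a :: u₂.map Sum.inr) q'
  | (_, _, _, none) => False

open Classical in
/-- The discrete transducer with the moves `Move` that write at most `2 * k` letters. -/
noncomputable def discretize [Fintype A] [Fintype B] [Fintype Q] (δ : Q → A ⊕ B → Q → Prop)
    (q₀ : Q) (acc : Q → Prop) (k : ℕ) : DiscreteTransducer A B (Option Q) where
  initial := {none}
  transitions := (Finset.univ ×ˢ Finset.univ ×ˢ boundedWords B (2 * k) ×ˢ Finset.univ).filter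
    (Move δ q₀)
  -- Here `none` counts as `q₀`; this decides whether the pair of empty words is accepted.
  accepting := Finset.univ.filter fun o => acc (o.getD q₀)

variable [Fintype A] [Fintype B] [Fintype Q] {δ : Q → A ⊕ B → Q → Prop} {q₀ : Q}
  {acc : Q → Prop} {k : ℕ}

theorem mem_discretize_transitions {e : Option Q × A × List B × Option Q} :
    e ∈ (discretize δ q₀ acc k).transitions ↔ e.2.2.1.length ≤ 2 * k ∧ Move δ q₀ e := by
  classical
  simp [discretize, mem_boundedWords]

theorem mem_discretize_accepting {o : Option Q} :
    o ∈ (discretize δ q₀ acc k).accepting ↔ acc (o.getD q₀) := by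
  classical
  simp [discretize]

theorem path_of_discretize_run {o o' : Option Q} {s : List A} {t : List B}
    (h : (discretize δ q₀ acc k).Run o s t o') :
    ∃ z, lefts z = s ∧ rights z = t ∧ Path δ (o.getD q₀) z (o'.getD q₀) := by
  induction h with
  | nil q => exact ⟨[], rfl, rfl, rfl⟩
  | @cons q q' q'' a w s t he _ ih =>
    obtain ⟨z, rfl, rfl, hz⟩ := ih
    have he := (mem_discretize_transitions.1 he).2
    rcases q' with _ | q'
    · rcases q with _ | q <;> exact he.elim
    rcases q with _ | q
    · obtain ⟨u₁, u₂, rfl, hp⟩ := he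
      exact ⟨_ ++ z, by simp, by simp, path_append.2 ⟨q', hp, hz⟩⟩
    · exact ⟨_ ++ z, by simp, by simp, path_append.2 ⟨q', he, hz⟩⟩

/-- Outputs preceding the first input letter cannot be written from a state `some r`. They are split
off as `u`, to be absorbed later by the first move from `none`. -/
theorem discretize_run_of_path
    (hk : ∀ q (u : List B) q', Path δ q (u.map Sum.inr) q' → u.length ≤ k)
    {z : List (A ⊕ B)} {q q' : Q} (h : Path δ q z q') :
    ∃ u r t, Path δ q (u.map Sum.inr) r ∧ rights z = u ++ t ∧
      (discretize δ q₀ acc k).Run (some r) (lefts z) t (some q') := by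
  induction z generalizing q with
  | nil => cases h; exact ⟨[], _, [], rfl, rfl, .nil _⟩
  | cons c z ih =>
    obtain ⟨r₀, hr₀, hz⟩ := h
    obtain ⟨u, r, t, hu, ht, hrun⟩ := ih hz
    rcases c with a | b
    · refine ⟨[], q, u ++ t, rfl, by simpa using ht, .cons (w := u) ?_ hrun⟩
      refine mem_discretize_transitions.2 ⟨?_, r₀, hr₀, hu⟩
      have := hk _ _ _ hu
      dsimp only; omega
    · exact ⟨b :: u, r, t, ⟨r₀, hr₀, hu⟩, by simpa using ht, hrun⟩

theorem discretize_relation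
    (hk : ∀ q (u : List B) q', Path δ q (u.map Sum.inr) q' → u.length ≤ k) :
    (discretize δ q₀ acc k).relation =
      {st | st ∈ pathRel δ q₀ acc ∧ (st.1 = [] → st.2 = [])} := by
  ext ⟨s, t⟩
  constructor
  · rintro ⟨q, hq, q', hq', hrun⟩
    obtain rfl : q = none := by simpa [discretize] using hq
    obtain ⟨z, hs, ht, hz⟩ := path_of_discretize_run hrun
    refine ⟨⟨z, _, hs, ht, hz, mem_discretize_accepting.1 hq'⟩, ?_⟩
    rintro h
    dsimp only at h hrun ⊢
    subst h
    cases hrun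
    rfl
  · rintro ⟨⟨z, q', rfl, rfl, hz, hacc⟩, hne⟩
    obtain ⟨u, r, t, hu, ht, hrun⟩ := discretize_run_of_path (q₀ := q₀) (acc := acc) hk hz
    dsimp only at hne ⊢
    refine ⟨none, by simp [discretize], ?_⟩
    rw [ht] at hne ⊢
    generalize lefts z = s at *
    rcases s with _ | ⟨a, s⟩
    · cases hrun
      have hnil : u = [] := by simpa using hne rfl
      subst hnil
      cases hu
      exact ⟨none, mem_discretize_accepting.2 hacc, .nil _⟩
    · refine ⟨some q', mem_discretize_accepting.2 hacc, ?_⟩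
      cases hrun with
      | @cons _ r' _ _ w _ t he hrun =>
        have he := (mem_discretize_transitions.1 he).2
        rcases r' with _ | r'
        · exact he.elim
        rw [← List.append_assoc]
        refine .cons (q' := some r') ?_ hrun
        obtain ⟨r₁, h₁, h₂⟩ := id he
        -- The first move writes two output blocks of length at most `k`, one on each side of its
        -- input letter; hence the bound `2 * k`.
        refine mem_discretize_transitions.2 ⟨?_, u, w, rfl, path_append.2 ⟨r, hu, he⟩⟩
        have := hk _ _ _ hu
        have := hk _ _ _ h₂
        simp only [List.length_append]; omega

theorem discretize_size_le : (discretize δ q₀ acc k).size ≤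
    Fintype.card A + Fintype.card B + 3 * (Fintype.card Q + 1) +
      (Fintype.card Q + 1) * (Fintype.card A * ((Fintype.card B + 1) ^ (2 * k) *
        (Fintype.card Q + 1))) * (3 + 2 * k) := by
  classical
  have h1 : (discretize δ q₀ acc k).accepting.card ≤ Fintype.card Q + 1 :=
    (Finset.card_le_univ _).trans (Fintype.card_option).le
  have h2 : (discretize δ q₀ acc k).initial.card = 1 := rfl
  have h3 : (discretize δ q₀ acc k).transitions.card ≤ (Fintype.card Q + 1) *
      (Fintype.card A * ((Fintype.card B + 1) ^ (2 * k) * (Fintype.card Q + 1))) := by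
    refine (Finset.card_filter_le _ _).trans ?_
    simp only [Finset.card_product, Finset.card_univ, Fintype.card_option]
    gcongr
    exact card_boundedWords_le B _
  have h4 : ∑ e ∈ (discretize δ q₀ acc k).transitions, (3 + e.2.2.1.length) ≤
      (discretize δ q₀ acc k).transitions.card * (3 + 2 * k) := by
    refine Finset.sum_le_card_nsmul _ _ _ fun e he => ?_
    have := (mem_discretize_transitions.1 he).1
    omega
  have h5 := h4.trans (Nat.mul_le_mul_right _ h3)
  unfold DiscreteTransducer.size
  rw [Fintype.card_option, h2]
  omega

end Discrete

/-! ### Constants of a timed transducer -/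

section Scale

variable {A B L X : Type*}

/-- A number is less than two to the power of its binary length, so products of denominators are
controlled by sums of lengths. -/
theorem den_prod_le (g : Guard X) :
    0 < (g.map fun c => c.const.den).prod ∧
      (g.map fun c => c.const.den).prod ≤ 2 ^ TimedTransducer.guardSize g := by
  induction g with
  | nil => simp [TimedTransducer.guardSize]
  | cons c g ih =>
    simp only [TimedTransducer.guardSize, List.map_cons, List.prod_cons, List.sum_cons] at ih ⊢
    refine ⟨Nat.mul_pos c.const.den_pos ih.1, ?_⟩
    rw [pow_add]
    refine Nat.mul_le_mul ((Nat.lt_size_self _).le.trans ?_) ih.2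
    exact Nat.pow_le_pow_right (by norm_num) (by omega)

/-- The product of the denominators of the constants of `T`. -/
noncomputable def commonDen (T : TimedTransducer A B L X) : ℕ :=
  ∏ s ∈ T.switches, (s.guard.map fun c => c.const.den).prod

variable [Fintype A] [Fintype B] [Fintype L] [Fintype X]

theorem commonDen_le (T : TimedTransducer A B L X) : commonDen T ≤ 2 ^ T.size := by
  calc commonDen T ≤ ∏ s ∈ T.switches, 2 ^ (3 + TimedTransducer.guardSize s.guard +
        s.resets.card) := by
        refine Finset.prod_le_prod' fun s _ => (den_prod_le s.guard).2.trans ?_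
        exact Nat.pow_le_pow_right (by norm_num) (by omega)
    _ = 2 ^ ∑ s ∈ T.switches, (3 + TimedTransducer.guardSize s.guard + s.resets.card) :=
        Finset.prod_pow_eq_pow_sum _ _ _
    _ ≤ 2 ^ T.size := Nat.pow_le_pow_right (by norm_num) (by unfold TimedTransducer.size; omega)

/-- A scaled constant is its numerator times the cofactor of its denominator in `commonDen T`. Each
factor is at most `2 ^ T.size`, whence the exponent `2 * T.size`. -/
theorem isScale_commonDen (T : TimedTransducer A B L X) :
    IsScale T (commonDen T) (2 ^ (2 * T.size)) := by
  refine ⟨Finset.prod_pos fun s _ => (den_prod_le s.guard).1, fun s hs c hc => ?_⟩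
  obtain ⟨m, hm⟩ : c.const.den ∣ commonDen T :=
    (List.dvd_prod (List.mem_map_of_mem (f := fun c => c.const.den) hc)).trans
      (Finset.dvd_prod_of_mem (fun s : Switch (A ⊕ B) L X =>
        (s.guard.map fun c => c.const.den).prod) hs)
  have hm1 : m ≤ 2 ^ T.size :=
    (Nat.le_of_dvd (Finset.prod_pos fun s _ => (den_prod_le s.guard).1) ⟨_, hm.trans
      (mul_comm _ _)⟩).trans (commonDen_le T)
  have hn : c.const.num ≤ 2 ^ T.size := by
    refine (Nat.lt_size_self _).le.trans (Nat.pow_le_pow_right (by norm_num) ?_)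
    have h1 : 2 + (Nat.size c.const.num + Nat.size c.const.den) ≤
        TimedTransducer.guardSize s.guard :=
      List.single_le_sum (fun _ _ => Nat.zero_le _) _ (List.mem_map_of_mem hc)
    have h2 := Finset.single_le_sum (f := fun s : Switch (A ⊕ B) L X =>
      3 + TimedTransducer.guardSize s.guard + s.resets.card) (fun _ _ => Nat.zero_le _) hs
    unfold TimedTransducer.size
    omega
  refine ⟨m * c.const.num, ?_, ?_⟩
  · rw [two_mul, pow_add]; exact Nat.mul_le_mul hm1 hn
  · have hden : (c.const.den : ℚ≥0) * c.const = c.const.num := by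
      rw [mul_comm]; exact NNRat.mul_den_eq_num _
    rw [hm]; push_cast
    rw [← hden]; ring

end Scale

/-! ### The exponential size bound -/

/-- The exponent of the bound on the size of the region transducer. -/
noncomputable def sizeBound : Polynomial ℕ :=
  2 * (Polynomial.X + (2 * Polynomial.X + 3) * Polynomial.X ^ 2 + 1) + 4 * Polynomial.X +
    2 * Polynomial.X ^ 2 + 4

/-- Here `n` counts locations with regions: `4 * M + 3` is the number of positions and `x + x * x`
the number of clocks and ordered pairs of clocks. The exponent `E` bounds `n + 1`, which enters
squared through the source and target of a transition. -/
theorem size_bound_aux {a b l x N M n : ℕ} (hN : a + b + l + x + 1 ≤ N) (hM : M = 2 ^ (2 * N))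
    (hn : n = l * (4 * M + 3) ^ (x + x * x)) :
    a + b + 3 * (n + 1) + (n + 1) * (a * ((b + 1) ^ (2 * l) * (n + 1))) * (3 + 2 * l) ≤
      2 ^ (2 * (N + (2 * N + 3) * N ^ 2 + 1) + 4 * N + 2 * N ^ 2 + 4) := by
  have hN2 : N < 2 ^ N := Nat.lt_two_pow_self
  set E := N + (2 * N + 3) * N ^ 2 + 1 with hE
  have h1 : n + 1 ≤ 2 ^ E := by
    have h4 : 4 * M + 3 ≤ 2 ^ (2 * N + 3) := by
      rw [pow_add, ← hM]
      have : 1 ≤ M := hM ▸ Nat.one_le_two_pow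
      omega
    have h5 : x + x * x ≤ N ^ 2 := by
      have : x + 1 ≤ N := by omega
      nlinarith
    have h6 : n ≤ 2 ^ (N + (2 * N + 3) * N ^ 2) := by
      rw [hn, pow_add 2, pow_mul 2 (2 * N + 3)]
      refine Nat.mul_le_mul (by omega) ((Nat.pow_le_pow_left h4 _).trans ?_)
      exact Nat.pow_le_pow_right (Nat.two_pow_pos _) h5
    have h7 : 1 ≤ 2 ^ (N + (2 * N + 3) * N ^ 2) := Nat.one_le_two_pow
    rw [hE, pow_succ]; omega
  have h2 : (b + 1) ^ (2 * l) ≤ 2 ^ (2 * N ^ 2) := by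
    calc (b + 1) ^ (2 * l) ≤ (2 ^ N) ^ (2 * l) := Nat.pow_le_pow_left (by omega) _
      _ = 2 ^ (2 * (N * l)) := by rw [← pow_mul]; ring_nf
      _ ≤ 2 ^ (2 * N ^ 2) := by
        refine Nat.pow_le_pow_right (by norm_num) ?_
        have : l ≤ N := by omega
        nlinarith
  have h3 : 3 + 2 * l ≤ 2 ^ (N + 2) := by rw [pow_add]; omega
  have ha : a ≤ 2 ^ N := by omega
  have hbig : (n + 1) * (a * ((b + 1) ^ (2 * l) * (n + 1))) * (3 + 2 * l) ≤
      2 ^ (2 * E + 2 * N + 2 * N ^ 2 + 2) := by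
    calc _ ≤ 2 ^ E * (2 ^ N * (2 ^ (2 * N ^ 2) * 2 ^ E)) * 2 ^ (N + 2) := by gcongr
      _ = _ := by simp only [← pow_add]; congr 1; ring
  have hmid : 3 * (n + 1) ≤ 2 ^ (2 * E + 2 * N + 2 * N ^ 2 + 2) := by
    calc 3 * (n + 1) ≤ 2 ^ (E + 2) := by rw [pow_add]; omega
      _ ≤ _ := Nat.pow_le_pow_right (by norm_num) (by omega)
  have hlow : a + b ≤ 2 ^ (2 * E + 2 * N + 2 * N ^ 2 + 2) :=
    (show a + b ≤ 2 ^ N by omega).trans (Nat.pow_le_pow_right (by norm_num) (by omega))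
  calc _ ≤ 2 ^ (2 * E + 2 * N + 2 * N ^ 2 + 2 + 2) := by rw [pow_add _ _ 2]; omega
    _ ≤ _ := Nat.pow_le_pow_right (by norm_num) (by omega)

/-- The untiming of a timed transducer without output cycles is defined, up to outputs on the empty
input, by a discrete transducer of exponential size. -/
theorem exists_discreteTransducer {A B L X : Type*} [Fintype A] [Fintype B] [Fintype L] [Fintype X]
    (T : TimedTransducer A B L X) (hT : T.NoOutputCycle) :
    ∃ (Q : Type) (_ : Fintype Q) (_ : Nonempty Q) (D : DiscreteTransducer A B Q),
      D.size ≤ 2 ^ sizeBound.eval T.size ∧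
      D.relation = {st | st ∈ untimedRel T.relation ∧ (st.1 = [] → st.2 = [])} := by
  classical
  set d := commonDen T
  set M := 2 ^ (2 * T.size) with hM
  have hbis := (isScale_commonDen T).isBisimulation
  set R := L × (X ⊕ X × X → Finset.Icc (-(2 * M + 1) : ℤ) (2 * M + 1))
  -- Renaming the states by `Fin` brings them into `Type`, whatever the universes of `L` and `X`.
  let e : R ≃ Fin (Fintype.card R) := Fintype.equivFin R
  have hbis' : IsBisimulation T (fun p => e (regionAbs d M p)) := by
    refine ⟨fun p p' h => hbis.loc p p' (e.injective h), fun p₁ p₂ a τ p₁' h hs => ?_⟩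
    obtain ⟨τ', p₂', h1, h2⟩ := hbis.step p₁ p₂ a τ p₁' (e.injective h) hs
    exact ⟨τ', p₂', h1, congrArg e h2⟩
  refine ⟨Option (Fin (Fintype.card R)), inferInstance, inferInstance,
    discretize (absStep T fun p => e (regionAbs d M p)) (e (regionAbs d M (T.start, fun _ => 0)))
      (absAcc T fun p => e (regionAbs d M p)) (Fintype.card L), ?_, ?_⟩
  · refine discretize_size_le.trans ?_
    have hev : sizeBound.eval T.size = 2 * (T.size + (2 * T.size + 3) * T.size ^ 2 + 1) +
        4 * T.size + 2 * T.size ^ 2 + 4 := by simp [sizeBound]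
    rw [hev]
    refine size_bound_aux (x := Fintype.card X) (by unfold TimedTransducer.size; omega) hM ?_
    rw [Fintype.card_fin]
    simp only [R, Fintype.card_prod, Fintype.card_fun, Fintype.card_sum, Fintype.card_coe,
      Int.card_Icc]
    congr 2
    omega
  · rw [hbis'.untimedRel_eq]
    exact discretize_relation fun q u q' hu => hbis'.length_le hT hu

/-! ### Timed transducers from discrete transducers -/

section Timed

variable {A B L : Type*}

open Classical in
/-- A labelled transition system as a timed transducer without clocks. -/
noncomputable def clockFree [Fintype A] [Fintype B] [Fintype L] (δ : L → A ⊕ B → L → Prop) (l₀ : L)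
    (acc : L → Prop) : TimedTransducer A B L Empty where
  start := l₀
  switches := (Finset.univ.filter fun e : L × (A ⊕ B) × L => δ e.1 e.2.1 e.2.2).image
    fun e => ⟨e.1, e.2.1, [], ∅, e.2.2⟩
  accepting := Finset.univ.filter acc

variable [Fintype A] [Fintype B] [Fintype L] {δ : L → A ⊕ B → L → Prop} {l₀ : L}
  {acc : L → Prop}

theorem mem_clockFree_switches {s : Switch (A ⊕ B) L Empty} :
    s ∈ (clockFree δ l₀ acc).switches ↔
      ∃ l a l', δ l a l' ∧ s = ⟨l, a, [], ∅, l'⟩ := by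
  classical
  simp only [clockFree, Finset.mem_image, Finset.mem_filter, Finset.mem_univ, true_and]
  constructor
  · rintro ⟨⟨l, a, l'⟩, h, rfl⟩; exact ⟨l, a, l', h, rfl⟩
  · rintro ⟨l, a, l', h, rfl⟩; exact ⟨⟨l, a, l'⟩, h, rfl⟩

theorem clockFree_step_iff {τ : ℝ≥0} {a : A ⊕ B} {p p' : L × (Empty → ℝ≥0)} :
    (clockFree δ l₀ acc).Step τ a p p' ↔ δ p.1 a p'.1 := by
  constructor
  · rintro ⟨r, ⟨hr, -⟩, s, hs, h1, h2, h3, -⟩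
    obtain ⟨l, a', l', h, rfl⟩ := mem_clockFree_switches.1 hs
    dsimp only at h1 h2 h3
    rwa [← hr, ← h1, ← h2, ← h3]
  · intro h
    exact ⟨p, ⟨rfl, fun x => x.elim⟩, _, mem_clockFree_switches.2 ⟨_, _, _, h, rfl⟩, rfl, rfl, rfl,
      by simp [Guard.Sat], fun x => x.elim⟩

/-- Without clocks the location is the whole state, so projecting to it is a bisimulation, with
delay zero as a valid answer to every step. -/
theorem clockFree_untimedRel :
    untimedRel (clockFree δ l₀ acc).relation = pathRel δ l₀ acc := by
  classical
  have hbis : IsBisimulation (clockFree δ l₀ acc) Prod.fst := by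
    refine ⟨fun p p' h => h, fun p₁ p₂ a τ p₁' h hs => ⟨0, p₁', ?_, rfl⟩⟩
    rw [clockFree_step_iff] at hs ⊢
    rwa [← h]
  rw [hbis.untimedRel_eq]
  have h1 : absStep (clockFree δ l₀ acc) Prod.fst = δ := by
    funext l a l'
    refine propext ⟨?_, fun h => ⟨(l, fun _ => 0), (l', fun _ => 0), 0, rfl, rfl,
      clockFree_step_iff.2 h⟩⟩
    rintro ⟨p, p', τ, rfl, rfl, h⟩
    exact clockFree_step_iff.1 h
  have h2 : absAcc (clockFree δ l₀ acc) Prod.fst = acc := by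
    funext l
    refine propext ⟨?_, fun h => ⟨(l, fun _ => 0), rfl, by simpa [clockFree] using h⟩⟩
    rintro ⟨p, rfl, h⟩
    simpa [clockFree] using h
  rw [h1, h2]
  rfl

theorem clockFree_outEdge {l l' : L} (h : (clockFree δ l₀ acc).OutEdge l l') :
    ∃ b, δ l (Sum.inr b) l' := by
  obtain ⟨s, hs, rfl, rfl, b, hb⟩ := h
  obtain ⟨l, a, l', h, rfl⟩ := mem_clockFree_switches.1 hs
  exact ⟨b, by rw [← hb]; exact h⟩

end Timed

/-! ### Letter-by-letter unfolding of a discrete transducer -/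

section Unfold

variable {A B Q : Type*}

/-- The letter-by-letter unfolding of a discrete transducer: a state is paired with the output that
remains to be written, and `none` stands for all initial states. -/
inductive Unfold (D : DiscreteTransducer A B Q) :
    Option (Q × List B) → A ⊕ B → Option (Q × List B) → Prop
  | start {q q' a u} : q ∈ D.initial → (q, a, u, q') ∈ D.transitions →
      Unfold D none (Sum.inl a) (some (q', u))
  | read {q q' a u} : (q, a, u, q') ∈ D.transitions →
      Unfold D (some (q, [])) (Sum.inl a) (some (q', u))
  | write {q b u} : Unfold D (some (q, b :: u)) (Sum.inr b) (some (q, u))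

/-- Acceptance in the unfolding of a discrete transducer. -/
def UnfoldAcc (D : DiscreteTransducer A B Q) : Option (Q × List B) → Prop
  | none => ∃ q ∈ D.initial, q ∈ D.accepting
  | some (q, u) => q ∈ D.accepting ∧ u = []

variable {D : DiscreteTransducer A B Q}

theorem unfold_path_write (q : Q) (u : List B) :
    Path (Unfold D) (some (q, u)) (u.map Sum.inr) (some (q, [])) := by
  induction u with
  | nil => rfl
  | cons b u ih => exact ⟨_, .write, ih⟩

theorem unfold_path_of_run {q q' : Q} {s : List A} {t : List B} (h : D.Run q s t q') :
    ∃ z, lefts z = s ∧ rights z = t ∧ Path (Unfold D) (some (q, [])) z (some (q', [])) := by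
  induction h with
  | nil q => exact ⟨[], rfl, rfl, rfl⟩
  | @cons q q' q'' a w s t he _ ih =>
    obtain ⟨z, rfl, rfl, hz⟩ := ih
    exact ⟨Sum.inl a :: (w.map Sum.inr ++ z), by simp, by simp, _, .read he,
      path_append.2 ⟨_, unfold_path_write _ _, hz⟩⟩

/-- The pending output `u` must be written before the next input letter can be read, and acceptance
requires it to be used up; so it is a prefix of the output. -/
theorem run_of_unfold_path {z : List (A ⊕ B)} {q : Q} {u : List B} {o : Option (Q × List B)}
    (h : Path (Unfold D) (some (q, u)) z o) (hacc : UnfoldAcc D o) :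
    ∃ t, ∃ q' ∈ D.accepting, rights z = u ++ t ∧ D.Run q (lefts z) t q' := by
  induction z generalizing q u with
  | nil =>
    cases h
    obtain ⟨hq, rfl⟩ := hacc
    exact ⟨[], q, hq, rfl, .nil q⟩
  | cons c z ih =>
    obtain ⟨r, hr, hz⟩ := h
    cases hr with
    | @read _ q₁ a v he =>
      obtain ⟨t, q', hq', ht, hrun⟩ := ih hz
      exact ⟨v ++ t, q', hq', by simpa using ht, .cons he hrun⟩
    | write =>
      obtain ⟨t, q', hq', ht, hrun⟩ := ih hz
      exact ⟨t, q', hq', by simpa using ht, by simpa using hrun⟩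

theorem unfold_pathRel : pathRel (Unfold D) none (UnfoldAcc D) = D.relation := by
  ext ⟨s, t⟩
  constructor
  · rintro ⟨z, o, rfl, rfl, hz, hacc⟩
    cases z with
    | nil =>
      cases hz
      obtain ⟨q, hq, hq'⟩ := hacc
      exact ⟨q, hq, q, hq', .nil q⟩
    | cons c z =>
      obtain ⟨r, hr, hz⟩ := hz
      cases hr with
      | @start q q₁ a v hq he =>
        obtain ⟨t, q', hq', ht, hrun⟩ := run_of_unfold_path hz hacc
        refine ⟨q, hq, q', hq', ?_⟩
        dsimp only
        rw [rights_inl, lefts_inl, ht]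
        exact .cons he hrun
  · rintro ⟨q, hq, q', hq', hrun⟩
    dsimp only at hrun
    cases hrun with
    | nil => exact ⟨[], none, rfl, rfl, rfl, q, hq, hq'⟩
    | @cons _ q₁ _ a w s t he hrun =>
      obtain ⟨z, rfl, rfl, hz⟩ := unfold_path_of_run hrun
      exact ⟨Sum.inl a :: (w.map Sum.inr ++ z), some (q', []), by simp, by simp,
        ⟨_, .start hq he, path_append.2 ⟨_, unfold_path_write _ _, hz⟩⟩, hq', rfl⟩

/-- Pulling a labelled transition system back along a map whose range is closed under transitions
does not change its relation. -/
theorem pathRel_restrict {P R : Type*} {δ : P → A ⊕ B → P → Prop} {acc : P → Prop} (i : R → P)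
    (hclosed : ∀ r a p, δ (i r) a p → p ∈ Set.range i) (r₀ : R) :
    pathRel (fun r a r' => δ (i r) a (i r')) r₀ (fun r => acc (i r)) = pathRel δ (i r₀) acc := by
  have key : ∀ z r p, Path δ (i r) z p ↔
      ∃ r', i r' = p ∧ Path (fun r a r' => δ (i r) a (i r')) r z r' := by
    intro z
    induction z with
    | nil =>
      intro r p
      constructor
      · intro h; exact ⟨r, h, rfl⟩
      · rintro ⟨r', rfl, h⟩; cases h; rfl
    | cons c z ih =>
      intro r p
      constructor
      · rintro ⟨p', hp', hz⟩
        obtain ⟨r', rfl⟩ := hclosed _ _ _ hp'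
        obtain ⟨r'', h1, h2⟩ := (ih r' p).1 hz
        exact ⟨r'', h1, r', hp', h2⟩
      · rintro ⟨r'', h1, r', hp', h2⟩
        exact ⟨i r', hp', (ih r' p).2 ⟨r'', h1, h2⟩⟩
  ext st
  constructor
  · rintro ⟨z, r, h1, h2, h3, h4⟩
    exact ⟨z, i r, h1, h2, (key z r₀ _).2 ⟨r, rfl, h3⟩, h4⟩
  · rintro ⟨z, p, h1, h2, h3, h4⟩
    obtain ⟨r, rfl, h⟩ := (key z r₀ p).1 h3
    exact ⟨z, r, h1, h2, h, h4⟩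

end Unfold

/-- Every discrete transducer is the untiming of a timed transducer without output cycles. -/
theorem exists_timedTransducer {A B Q : Type*} [Fintype A] [Fintype B] [Fintype Q]
    (D : DiscreteTransducer A B Q) :
    ∃ (L X : Type) (_ : Fintype L) (_ : Fintype X) (T : TimedTransducer A B L X),
      T.NoOutputCycle ∧ untimedRel T.relation = D.relation := by
  classical
  let k := D.transitions.sup fun e => e.2.2.1.length
  have hk : ∀ e ∈ D.transitions, e.2.2.1.length ≤ k := fun e he =>
    Finset.le_sup (f := fun e : Q × A × List B × Q => e.2.2.1.length) he
  -- Pending outputs are suffixes of transition outputs, so words of length at most `k` suffice and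
  -- the unfolding becomes finite.
  let F : Finset (Option (Q × List B)) := (Finset.univ ×ˢ boundedWords B k).insertNone
  have hF : ∀ q u, some (q, u) ∈ F ↔ u.length ≤ k := by
    intro q u
    simp [F, mem_boundedWords]
  let i : Fin F.card → Option (Q × List B) := fun j => (F.equivFin.symm j).1
  have hrange : ∀ o ∈ F, ∃ j, i j = o := fun o ho => ⟨F.equivFin ⟨o, ho⟩, by simp [i]⟩
  have hclosed : ∀ r a p, Unfold D (i r) a p → p ∈ Set.range i := by
    intro r a p h
    have hr : i r ∈ F := (F.equivFin.symm r).2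
    generalize i r = o at *
    cases h with
    | start _ he => exact hrange _ ((hF _ _).2 (hk _ he))
    | read he => exact hrange _ ((hF _ _).2 (hk _ he))
    | write =>
      have := (hF _ _).1 hr
      exact hrange _ ((hF _ _).2 (by simp only [List.length_cons] at this; omega))
  obtain ⟨j₀, hj₀⟩ := hrange none (by simp [F])
  refine ⟨Fin F.card, Empty, inferInstance, inferInstance,
    clockFree (fun r a r' => Unfold D (i r) a (i r')) j₀ (fun r => UnfoldAcc D (i r)), ?_, ?_⟩
  -- The length of the pending output drops along every output switch. The value at `none` is
  -- immaterial, as no output switch touches it.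
  · let rank : Option (Q × List B) → ℕ := fun o => o.elim 0 fun p => p.2.length
    intro l hl
    have hdec : ∀ l l', Relation.TransGen (clockFree (fun r a r' => Unfold D (i r) a (i r')) j₀
        (fun r => UnfoldAcc D (i r))).OutEdge l l' → rank (i l') < rank (i l) := by
      have hedge : ∀ l l', (clockFree (fun r a r' => Unfold D (i r) a (i r')) j₀
          (fun r => UnfoldAcc D (i r))).OutEdge l l' → rank (i l') < rank (i l) := by
        intro l l' h
        obtain ⟨b, hb⟩ := clockFree_outEdge h
        generalize i l = o at *
        generalize i l' = o' at *
        cases hb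
        simp [rank]
      intro l l' h
      induction h with
      | single h => exact hedge _ _ h
      | tail _ h ih => exact (hedge _ _ h).trans ih
    exact lt_irrefl _ (hdec l l hl)
  · rw [clockFree_untimedRel, pathRel_restrict i hclosed, hj₀, unfold_pathRel]

end TimedTransduction

theorem mainTheorem12 :
    (∃ p : Polynomial ℕ,
      ∀ (A B L X : Type*) [Fintype A] [Fintype B] [Fintype L] [Fintype X]
        (T : TimedTransduction.TimedTransducer A B L X), T.NoOutputCycle →
        ∃ (Q : Type) (_ : Fintype Q) (_ : Nonempty Q)
          (D : TimedTransduction.DiscreteTransducer A B Q),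
          D.size ≤ 2 ^ p.eval T.size ∧
          D.relation =
            {st | st ∈ TimedTransduction.untimedRel T.relation ∧ (st.1 = [] → st.2 = [])}) ∧
    (∀ (A B Q : Type*) [Fintype A] [Fintype B] [Fintype Q] [Nonempty Q]
        (D : TimedTransduction.DiscreteTransducer A B Q),
        ∃ (L X : Type) (_ : Fintype L) (_ : Fintype X)
          (T : TimedTransduction.TimedTransducer A B L X),
          T.NoOutputCycle ∧ TimedTransduction.untimedRel T.relation = D.relation) := by
  exact ⟨⟨TimedTransduction.sizeBound, fun _ _ _ _ _ _ _ _ T hT =>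
      TimedTransduction.exists_discreteTransducer T hT⟩,
    fun _ _ _ _ _ _ _ D => TimedTransduction.exists_timedTransducer D⟩
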